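/- There is a universal constant $C>0$ (not depending on any parameter) such that the following holds. Let $n$ be a positive integer, let $u_1,\ldots,u_n$ be real numbers, not all equal, and let $\pi$ be a random permutation uniformly distributed on the symmetric group $S_n$ of all permutations of $\{1,\ldots,n\}$. Then, for every $x\in\mathbb R$, $$\mathbb P\Bigl\{\sum_{i=1}^{n}u_{i}\,\pi(i)=x\Bigr\}\le\frac{C}{n}.$$ -/

import Mathlib

/-- Every event (set of permutations) of the finite symmetric group is measurable. -/
instance symmGroupMeasurableSpace (n : ℕ) : MeasurableSpace (Equiv.Perm (Fin n)) := ⊤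

/-- The law of a uniformly distributed random permutation in the symmetric group of `n` letters. -/
noncomputable def uniformPerm (n : ℕ) : MeasureTheory.Measure (Equiv.Perm (Fin n)) :=
  (PMF.uniformOfFintype (Equiv.Perm (Fin n))).toMeasure

/-- The value `π(i) ∈ {1, …, n}`, as a real number, for `π` a permutation of `{1, …, n}`;
the letters `1, …, n` are the elements `0, …, n - 1` of `Fin n`, shifted by one. -/
noncomputable def permValue {n : ℕ} (π : Equiv.Perm (Fin n)) (i : Fin n) : ℝ :=
  ((π i : ℕ) : ℝ) + 1

open Finset

/-! Let `M` be the set where `u` is maximal and `i ∈ M`. Sliding the value at `i` upwards, with the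
order of the others kept, never decreases the sum, and strictly increases it whenever `i` passes a
letter outside `M`. So among the positions where `i` ends a run of `M`, at most one gives the sum
`x`, while all but `#M - 1` positions are of this kind. Averaging over `i` with weight one over the
number of run ends, which a move at most doubles, gives `card_level_le`. Used for `u` and `-u`,
whose maximal sets are disjoint, it gives the constant 4. -/

/-- The permutation obtained from `π` by moving the value at `i` to `p`, keeping the relative order
of all other values. -/
def moveValue {n : ℕ} (i p : Fin (n + 1)) (π : Equiv.Perm (Fin (n + 1))) :
    Equiv.Perm (Fin (n + 1)) :=
  π.trans ((finSuccEquiv' (π i)).trans (finSuccEquiv' p).symm)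

@[simp] lemma moveValue_self {n : ℕ} (i p : Fin (n + 1)) (π : Equiv.Perm (Fin (n + 1))) :
    moveValue i p π i = p := by
  simp [moveValue]

lemma moveValue_succAbove {n : ℕ} (i p j : Fin (n + 1)) (π : Equiv.Perm (Fin (n + 1)))
    (k : Fin n) (h : π j = (π i).succAbove k) : moveValue i p π j = p.succAbove k := by
  simp [moveValue, h]

lemma exists_eq_succAbove {n : ℕ} {i j : Fin (n + 1)} (π : Equiv.Perm (Fin (n + 1)))
    (h : j ≠ i) : ∃ k, π j = (π i).succAbove k := by
  obtain ⟨k, hk⟩ := Fin.exists_succAbove_eq (fun e => h (π.injective e) : π j ≠ π i)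
  exact ⟨k, hk.symm⟩

lemma moveValue_moveValue {n : ℕ} (i p q : Fin (n + 1)) (π : Equiv.Perm (Fin (n + 1))) :
    moveValue i q (moveValue i p π) = moveValue i q π := by
  ext1 j
  by_cases hj : j = i
  · subst hj; simp
  · obtain ⟨k, hk⟩ := exists_eq_succAbove π hj
    rw [moveValue_succAbove i q j π k hk]
    apply moveValue_succAbove
    rw [moveValue_self, moveValue_succAbove i p j π k hk]

lemma moveValue_apply_self {n : ℕ} (i : Fin (n + 1)) (π : Equiv.Perm (Fin (n + 1))) :
    moveValue i (π i) π = π := by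
  ext1 j
  simp [moveValue]

lemma val_succAbove {n : ℕ} (p : Fin (n + 1)) (k : Fin n) :
    (p.succAbove k : ℕ) = if (k : ℕ) < p then (k : ℕ) else k + 1 := by
  by_cases h : (k : ℕ) < p
  · rw [if_pos h, Fin.succAbove_of_castSucc_lt _ _ (by simpa [Fin.lt_def] using h)]; simp
  · rw [if_neg h, Fin.succAbove_of_le_castSucc _ _ (by simpa [Fin.le_def] using h)]; simp

/-- The elements of `M` at which a run of `M` ends, reading the letters in the order given
by `π`. -/
def runEnds {n : ℕ} (M : Finset (Fin n)) (π : Equiv.Perm (Fin n)) : Finset (Fin n) :=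
  {i ∈ M | ∀ j ∈ M, (π j : ℕ) ≠ π i + 1}

lemma mem_runEnds {n : ℕ} {M : Finset (Fin n)} {π : Equiv.Perm (Fin n)} {i : Fin n} :
    i ∈ runEnds M π ↔ i ∈ M ∧ ∀ j ∈ M, (π j : ℕ) ≠ π i + 1 := by
  simp [runEnds]

lemma runEnds_nonempty {n : ℕ} {M : Finset (Fin n)} (hM : M.Nonempty)
    (π : Equiv.Perm (Fin n)) : (runEnds M π).Nonempty := by
  obtain ⟨i, hi, h⟩ := M.exists_max_image (fun j => (π j : ℕ)) hM
  exact ⟨i, mem_runEnds.2 ⟨hi, fun j hj e => by have := h j hj; omega⟩⟩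

/-- A letter `j ≠ i` followed by some `l ≠ i` in `M` is, after the move, followed by `l` or by `i`,
both in `M`. -/
lemma runEnds_moveValue_subset {n : ℕ} {M : Finset (Fin (n + 1))} {i p : Fin (n + 1)}
    {π : Equiv.Perm (Fin (n + 1))} (hi : i ∈ runEnds M π) {j : Fin (n + 1)}
    (hj : j ∈ runEnds M (moveValue i p π)) (hne : (π i : ℕ) ≠ π j + 1) : j ∈ runEnds M π := by
  by_cases hji : j = i
  · rwa [hji]
  rw [mem_runEnds] at hi hj ⊢
  refine ⟨hj.1, fun l hl e => ?_⟩
  have hli : l ≠ i := by rintro rfl; exact hne e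
  obtain ⟨k, hk⟩ := exists_eq_succAbove π hji
  obtain ⟨k', hk'⟩ := exists_eq_succAbove π hli
  have h1 := hj.2 l hl
  have h2 := hj.2 i hi.1
  rw [moveValue_succAbove i p j π k hk] at h1 h2
  rw [moveValue_succAbove i p l π k' hk'] at h1
  rw [moveValue_self] at h2
  rw [hk] at hne
  rw [hk, hk'] at e
  simp only [val_succAbove] at h1 h2 hne e
  split_ifs at h1 h2 hne e <;> omega

/-- Only the predecessor of `i` can be a new run end, and `r + 1 ≤ 2 * r` for `r ≥ 1`. -/
lemma card_runEnds_moveValue_le {n : ℕ} {M : Finset (Fin (n + 1))} {i : Fin (n + 1)}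
    (p : Fin (n + 1)) {π : Equiv.Perm (Fin (n + 1))} (hi : i ∈ runEnds M π) :
    #(runEnds M (moveValue i p π)) ≤ 2 * #(runEnds M π) := by
  have hsub : runEnds M (moveValue i p π) ⊆
      runEnds M π ∪ ({j | (π i : ℕ) = π j + 1} : Finset (Fin (n + 1))) := by
    intro j hj
    by_cases h : (π i : ℕ) = π j + 1
    · simp [h]
    · exact mem_union_left _ (runEnds_moveValue_subset hi hj h)
  have h1 : #({j | (π i : ℕ) = π j + 1} : Finset (Fin (n + 1))) ≤ 1 := by
    refine card_le_one.2 fun a ha b hb => π.injective (Fin.ext ?_)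
    simp only [mem_filter, mem_univ, true_and] at ha hb
    omega
  have h2 : 0 < #(runEnds M π) := card_pos.2 ⟨i, hi⟩
  have h3 := (card_le_card hsub).trans (card_union_le _ _)
  omega

lemma card_le_card_moveValue_runEnds {n : ℕ} {M : Finset (Fin (n + 1))} {i : Fin (n + 1)}
    (hi : i ∈ M) (π : Equiv.Perm (Fin (n + 1))) :
    n + 2 ≤ #{p | i ∈ runEnds M (moveValue i p π)} + #M := by
  have hbad : #{p | ¬ i ∈ runEnds M (moveValue i p π)} ≤ #(M.erase i) := by
    -- A bad `p` puts `i` just before some `j` of `M`, so `p` is the rank of `j` among the letters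
    -- other than `i`.
    have hex : ∀ p ∈ ({p | ¬ i ∈ runEnds M (moveValue i p π)} : Finset (Fin (n + 1))),
        ∃ j ∈ M.erase i, ∃ k, π j = (π i).succAbove k ∧ (k : ℕ) = p := by
      intro p hp
      simp only [mem_filter, mem_univ, true_and, mem_runEnds, hi, not_forall, not_not] at hp
      obtain ⟨j, hj, e⟩ := hp
      rw [moveValue_self] at e
      have hji : j ≠ i := by
        rintro rfl
        rw [moveValue_self] at e
        omega
      obtain ⟨k, hk⟩ := exists_eq_succAbove π hji
      rw [moveValue_succAbove i p j π k hk, val_succAbove] at e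
      refine ⟨j, mem_erase.2 ⟨hji, hj⟩, k, hk, ?_⟩
      split_ifs at e <;> omega
    choose! f hf k hk using hex
    refine card_le_card_of_injOn f hf fun a ha b hb hab => Fin.ext ?_
    have h1 := hk a ha
    have h2 := hk b hb
    rw [hab, h2.1] at h1
    rw [← h1.2, ← h2.2, Fin.succAbove_right_injective h1.1]
  have h1 := card_filter_add_card_filter_not (s := (univ : Finset (Fin (n + 1))))
    (fun p => i ∈ runEnds M (moveValue i p π))
  have h2 := card_erase_add_one hi
  rw [card_univ, Fintype.card_fin] at h1
  omega

lemma sum_mul_moveValue_lt {n : ℕ} {u : Fin (n + 1) → ℝ} {i : Fin (n + 1)}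
    (hmax : ∀ j, u j ≤ u i) (π : Equiv.Perm (Fin (n + 1))) {p q : Fin (n + 1)} (hpq : p < q)
    (hp : i ∈ runEnds {j | u j = u i} (moveValue i p π)) :
    ∑ j, u j * (moveValue i p π j : ℕ) < ∑ j, u j * (moveValue i q π j : ℕ) := by
  -- Subtracting `u i` shifts all the sums equally and removes the term of `i`; the other
  -- coefficients are nonpositive, and their letters move down or stay.
  have key : ∑ j, (u j - u i) * ((moveValue i p π j : ℕ) : ℝ) <
      ∑ j, (u j - u i) * ((moveValue i q π j : ℕ) : ℝ) := by
    refine sum_lt_sum (fun j _ => ?_) ?_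
    · by_cases hj : j = i
      · simp [hj]
      obtain ⟨k, hk⟩ := exists_eq_succAbove π hj
      rw [moveValue_succAbove i p j π k hk, moveValue_succAbove i q j π k hk]
      refine mul_le_mul_of_nonpos_left ?_ (sub_nonpos.2 (hmax j))
      rw [Nat.cast_le, val_succAbove, val_succAbove]
      have : (p : ℕ) < q := hpq
      split_ifs <;> omega
    · have hpq' : (p : ℕ) < q := hpq
      have hpn : (p : ℕ) < n := by omega
      -- The letter right after `i` when `i` sits at `p`; it lies outside `M`.
      set j := π.symm ((π i).succAbove ⟨p, hpn⟩) with hj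
      have hk : π j = (π i).succAbove ⟨p, hpn⟩ := by simp [hj]
      refine ⟨j, mem_univ _, ?_⟩
      have hne := (mem_runEnds.1 hp).2 j
      rw [moveValue_succAbove i p j π _ hk, moveValue_self, val_succAbove] at hne
      have hlt : u j < u i := by
        refine lt_of_le_of_ne (hmax j) fun e => hne (by simpa using e) ?_
        simp
      rw [moveValue_succAbove i p j π _ hk, moveValue_succAbove i q j π _ hk]
      refine mul_lt_mul_of_neg_left ?_ (sub_neg.2 hlt)
      rw [Nat.cast_lt, val_succAbove, val_succAbove]
      simp [hpq']
  have hconst : ∀ τ : Equiv.Perm (Fin (n + 1)), ∑ j, (u j - u i) * ((τ j : ℕ) : ℝ) =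
      ∑ j, u j * ((τ j : ℕ) : ℝ) - u i * ∑ j : Fin (n + 1), ((j : ℕ) : ℝ) := by
    intro τ
    rw [← Equiv.sum_comp τ (fun j : Fin (n + 1) => ((j : ℕ) : ℝ)), mul_sum, ← sum_sub_distrib]
    exact sum_congr rfl fun j _ => sub_mul _ _ _
  rw [hconst, hconst] at key
  linarith

/-- The map `(π, p) ↦ (moveValue i p π, π i)` is an involution. -/
lemma sum_sum_moveValue_comm {n : ℕ} (i : Fin (n + 1))
    (g : Equiv.Perm (Fin (n + 1)) → Equiv.Perm (Fin (n + 1)) → ℝ) :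
    ∑ π, ∑ p, g π (moveValue i p π) = ∑ π, ∑ p, g (moveValue i p π) π := by
  rw [← Fintype.sum_prod_type', ← Fintype.sum_prod_type']
  have hinv : ∀ a : Equiv.Perm (Fin (n + 1)) × Fin (n + 1),
      moveValue i (a.1 i) (moveValue i a.2 a.1) = a.1 := fun a => by
    rw [moveValue_moveValue, moveValue_apply_self]
  refine sum_nbij' (fun a => (moveValue i a.2 a.1, a.1 i)) (fun a => (moveValue i a.2 a.1, a.1 i))
    (by simp) (by simp) ?_ ?_ ?_
  · intro a _; simp [hinv]
  · intro a _; simp [hinv]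
  · intro a _; simp [hinv]

/-- If the maximum of `u` is attained on `M`, the level sets of `π ↦ ∑ j, u j * π j` have
density at most `2 / (n - #M + 1)`, for permutations of `n` letters. -/
lemma card_level_le {n : ℕ} {u : Fin (n + 1) → ℝ} {c : ℝ} (hmax : ∀ j, u j ≤ c)
    {M : Finset (Fin (n + 1))} (hMdef : M = univ.filter fun j => u j = c) (hM : M.Nonempty) (x : ℝ) :
    ((n : ℝ) + 2 - #M) * #{π : Equiv.Perm (Fin (n + 1)) | ∑ j, u j * (π j : ℕ) = x} ≤
      2 * (n + 1).factorial := by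
  classical
  set A : Finset (Equiv.Perm (Fin (n + 1))) := {π | ∑ j, u j * (π j : ℕ) = x} with hA
  have hR : ∀ π, (0 : ℝ) < #(runEnds M π) := fun π =>
    Nat.cast_pos.2 (card_pos.2 (runEnds_nonempty hM π))
  have hone : ∀ π, ∑ i, (if i ∈ runEnds M π then (#(runEnds M π) : ℝ)⁻¹ else 0) = 1 := by
    intro π
    rw [← sum_filter, sum_const, nsmul_eq_mul]
    simp [(hR π).ne']
  -- The weight uses the run ends of the moved `τ`, so that after swapping the roles it sums to 1
  -- over `i`.
  let g : Fin (n + 1) → Equiv.Perm (Fin (n + 1)) → Equiv.Perm (Fin (n + 1)) → ℝ :=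
    fun i π τ =>
      if π ∈ A ∧ i ∈ runEnds M π ∧ i ∈ runEnds M τ then (#(runEnds M τ) : ℝ)⁻¹ else 0
  have lower : ((n : ℝ) + 2 - #M) * #A ≤ 2 * ∑ i, ∑ π, ∑ p, g i π (moveValue i p π) := by
    rw [sum_comm, mul_sum, ← nsmul_eq_mul', ← sum_const, ← sum_filter_add_sum_filter_not univ (· ∈ A)]
    have h0 : 0 ≤ ∑ π with ¬ π ∈ A, 2 * ∑ i, ∑ p, g i π (moveValue i p π) := by
      refine sum_nonneg fun π _ => mul_nonneg zero_le_two
        (sum_nonneg fun i _ => sum_nonneg fun p _ => ?_)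
      dsimp only [g]
      split_ifs <;> positivity
    refine le_add_of_le_of_nonneg ?_ h0
    rw [filter_mem_eq_inter, univ_inter]
    refine sum_le_sum fun π hπ => ?_
    rw [mul_sum, ← mul_one ((n : ℝ) + 2 - #M), ← hone π, mul_sum]
    refine sum_le_sum fun i _ => ?_
    by_cases hi : i ∈ runEnds M π
    · have hcard := card_le_card_moveValue_runEnds (mem_runEnds.1 hi).1 π
      have hcard' : (n : ℝ) + 2 - #M ≤ #{p | i ∈ runEnds M (moveValue i p π)} := by
        rw [sub_le_iff_le_add]
        exact_mod_cast hcard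
      rw [if_pos hi]
      calc ((n : ℝ) + 2 - #M) * (#(runEnds M π) : ℝ)⁻¹
          ≤ #{p | i ∈ runEnds M (moveValue i p π)} * (#(runEnds M π) : ℝ)⁻¹ := by gcongr
        _ = ∑ p with i ∈ runEnds M (moveValue i p π), (#(runEnds M π) : ℝ)⁻¹ := by
          rw [sum_const, nsmul_eq_mul]
        _ ≤ ∑ p with i ∈ runEnds M (moveValue i p π),
              2 * (#(runEnds M (moveValue i p π)) : ℝ)⁻¹ := by
          refine sum_le_sum fun p _ => ?_
          have h2 : (#(runEnds M (moveValue i p π)) : ℝ) ≤ 2 * #(runEnds M π) := by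
            exact_mod_cast card_runEnds_moveValue_le p hi
          rw [← div_eq_mul_inv, inv_eq_one_div, div_le_div_iff₀ (hR _) (hR _)]
          linarith
        _ = 2 * ∑ p, g i π (moveValue i p π) := by
          rw [← mul_sum, sum_filter]
          simp [g, hπ, hi]
    · simp [g, hi]
  have upper : ∑ i, ∑ π, ∑ p, g i π (moveValue i p π) ≤ (n + 1).factorial := by
    calc ∑ i, ∑ π, ∑ p, g i π (moveValue i p π)
        = ∑ i, ∑ π, ∑ p, g i (moveValue i p π) π :=
          sum_congr rfl fun i _ => sum_sum_moveValue_comm i (g i)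
      _ ≤ ∑ i, ∑ π, (if i ∈ runEnds M π then (#(runEnds M π) : ℝ)⁻¹ else 0) := by
          refine sum_le_sum fun i _ => sum_le_sum fun π _ => ?_
          by_cases hi : i ∈ runEnds M π
          swap
          · simp [g, hi]
          have huniq : #{p | moveValue i p π ∈ A ∧ i ∈ runEnds M (moveValue i p π)} ≤ 1 := by
            have hui : u i = c := by simpa [hMdef] using (mem_runEnds.1 hi).1
            rw [← hui] at hmax hMdef
            have hlt : ∀ p q, p < q → moveValue i p π ∈ A → moveValue i q π ∈ A →
                i ∉ runEnds M (moveValue i p π) := by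
              intro p q hpq hp hq hpi
              rw [hMdef] at hpi
              have := sum_mul_moveValue_lt hmax π hpq hpi
              rw [hA, mem_filter] at hp hq
              rw [hp.2, hq.2] at this
              exact lt_irrefl _ this
            refine card_le_one.2 fun p hp q hq => ?_
            simp only [mem_filter, mem_univ, true_and] at hp hq
            rcases lt_trichotomy p q with h | h | h
            · exact absurd hp.2 (hlt p q h hp.1 hq.1)
            · exact h
            · exact absurd hq.2 (hlt q p h hq.1 hp.1)
          have hsum : ∑ p, g i (moveValue i p π) π =
              #{p | moveValue i p π ∈ A ∧ i ∈ runEnds M (moveValue i p π)} *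
                (#(runEnds M π) : ℝ)⁻¹ := by
            simp only [g, hi, and_true]
            rw [← sum_filter, sum_const, nsmul_eq_mul]
          rw [hsum, if_pos hi]
          exact mul_le_of_le_one_left (inv_nonneg.2 (hR π).le) (by exact_mod_cast huniq)
      _ = (n + 1).factorial := by
          rw [sum_comm, sum_congr rfl fun π _ => hone π]
          simp [Fintype.card_perm]
  linarith

/-- Level sets of `π ↦ ∑ j, u j * π j` have density at most `4 / n`. -/
lemma card_level_le_of_ne {n : ℕ} {u : Fin (n + 1) → ℝ} (hu : ∃ i j, u i ≠ u j) (x : ℝ) :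
    ((n : ℝ) + 1) * #{π : Equiv.Perm (Fin (n + 1)) | ∑ j, u j * (π j : ℕ) = x} ≤
      4 * (n + 1).factorial := by
  classical
  obtain ⟨a, -, ha⟩ := exists_max_image univ u univ_nonempty
  obtain ⟨b, -, hb⟩ := exists_min_image univ u univ_nonempty
  have hab : u b ≠ u a := by
    obtain ⟨i, j, hij⟩ := hu
    intro e
    apply hij
    linarith [ha i (mem_univ _), ha j (mem_univ _), hb i (mem_univ _), hb j (mem_univ _)]
  have hdisj : Disjoint ({j | u j = u a} : Finset (Fin (n + 1)))
      ({j | -u j = -u b} : Finset (Fin (n + 1))) := by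
    rw [disjoint_filter]
    intro j _ h1 h2
    exact hab (by linarith)
  have hcard := card_le_univ
    (({j | u j = u a} : Finset (Fin (n + 1))) ∪
      ({j | -u j = -u b} : Finset (Fin (n + 1))))
  rw [card_union_of_disjoint hdisj, Fintype.card_fin] at hcard
  have hcard' : (#{j | u j = u a} : ℝ) + #{j | -u j = -u b} ≤ n + 1 := by exact_mod_cast hcard
  have h1 := card_level_le (u := u) (fun j => ha j (mem_univ _)) rfl ⟨a, by simp⟩ x
  have h2 := card_level_le (u := fun j => -u j) (fun j => neg_le_neg (hb j (mem_univ _))) rfl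
    ⟨b, by simp⟩ (-x)
  simp only [neg_mul, sum_neg_distrib, neg_inj (b := x)] at h2
  set N : ℝ := (#{π : Equiv.Perm (Fin (n + 1)) | ∑ j, u j * (π j : ℕ) = x} : ℝ)
  have hN : 0 ≤ N := Nat.cast_nonneg _
  -- Adding `h1` and `h2` gives the factor `2 * n + 4` minus both cardinalities, hence at least `n +
  -- 3`.
  nlinarith [mul_le_mul_of_nonneg_right hcard' hN]

lemma uniformPerm_real (n : ℕ) (s : Set (Equiv.Perm (Fin n))) [DecidablePred (· ∈ s)] :
    (uniformPerm n).real s = #{π | π ∈ s} / n.factorial := by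
  rw [MeasureTheory.measureReal_def, uniformPerm,
    PMF.toMeasure_uniformOfFintype_apply s trivial]
  simp [Fintype.card_perm, Fintype.card_subtype]

theorem corollary5 :
    ∃ C : ℝ, 0 < C ∧
      ∀ (n : ℕ) (u : Fin n → ℝ), (∃ i j : Fin n, u i ≠ u j) →
        ∀ x : ℝ,
          (uniformPerm n).real {π : Equiv.Perm (Fin n) | ∑ i : Fin n, u i * permValue π i = x}
            ≤ C / (n : ℝ) := by
  classical
  refine ⟨4, by norm_num, fun n u hu x => ?_⟩
  cases n with
  | zero => exact hu.choose.elim0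
  | succ n =>
    rw [uniformPerm_real]
    -- `permValue` starts at 1, which shifts the target by `∑ j, u j`.
    have h := card_level_le_of_ne hu (x - ∑ j, u j)
    have hset : ({π | π ∈ {π : Equiv.Perm (Fin (n + 1)) | ∑ i, u i * permValue π i = x}} :
        Finset (Equiv.Perm (Fin (n + 1)))) =
        ({π | ∑ j, u j * (π j : ℕ) = x - ∑ j, u j} : Finset (Equiv.Perm (Fin (n + 1)))) := by
      ext π
      simp [permValue, mul_add, sum_add_distrib, eq_sub_iff_add_eq]
    rw [hset, div_le_div_iff₀ (by positivity) (by positivity)]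
    push_cast at h ⊢
    linarith
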